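/- Let $(\tilde M,\tilde g)$ be a smooth ($C^\infty$), finite-dimensional Riemannian manifold without boundary, with Riemannian distance $\tilde d$, and let $G$ be a finite group acting freely on $\tilde M$ by smooth isometries. Let $M=\tilde M/G$ be the quotient manifold, $\mathrm{quo}:\tilde M\to M$ the quotient map, $g$ the unique Riemannian metric on $M$ for which $\mathrm{quo}$ is a local isometry, and $d$ the Riemannian distance of $(M,g)$. (Connectedness is not required; the Riemannian distance between points of different connected components is $+\infty$.) Let $N\ge 1$ and $Q=(q_1,\dots,q_N)\in M^N$. The Fréchet mean set $\mathrm{FM}(Q)\subseteq M$ is the set of minimizers over $p\in M$ of $\int_M d(\cdot,p)^2\,d\mu_Q$, where $\mu_Q=\frac1N\sum_{i=1}^N\delta_{q_i}$. The set $\mathrm{EFM}(Q)\subseteq\tilde M$ of equivariant Fréchet means of $Q$ is the set of minimizers over $\tilde p\in\tilde M$ of $\tilde f_Q(\tilde p)=\frac1N\sum_{i=1}^N \tilde d(\mathrm{quo}^{-1}(q_i),\tilde p)^2$, where $\tilde d(A,\tilde p)=\inf_{a\in A}\tilde d(a,\tilde p)$. Then: (a) For every $\tilde p\in\tilde M$,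 with $p=\mathrm{quo}(\tilde p)$, the following are equivalent: (i) $p\in\mathrm{FM}(Q)$; (ii) $\tilde p\in\mathrm{EFM}(Q)$; (iii) $\mathrm{quo}^{-1}(p)\subseteq\mathrm{EFM}(Q)$. Thus $\mathrm{EFM}(Q)=\mathrm{quo}^{-1}(\mathrm{FM}(Q))$ and $\mathrm{quo}(\mathrm{EFM}(Q))=\mathrm{FM}(Q)$. (b) $Q$ has a unique Fréchet mean (i.e. $\mathrm{FM}(Q)$ consists of exactly one point) if and only if $\mathrm{EFM}(Q)$ is non-empty and any two elements of $\mathrm{EFM}(Q)$ are related by the action of an element of $G$. If $(\tilde M,\tilde g)$ is complete, the non-emptiness condition may be dropped: $Q$ has a unique Fréchet mean if and only if any two equivariant Fréchet means of $Q$ are related by the action of an element of $G$. -/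

import Mathlib

open MeasureTheory Set Filter Manifold Bundle
open scoped Topology ContDiff ENNReal

namespace EquivariantMean

section Quotient

variable {E : Type*} [NormedAddCommGroup E] [NormedSpace ℝ E]
  {H : Type*} [TopologicalSpace H] (I : ModelWithCorners ℝ E H)
  (G : Type*) [Group G] {X : Type*} [MulAction G X]

/-- The quotient map `quo : X → X / G`. -/
def quo (x : X) : MulAction.orbitRel.Quotient G X := Quotient.mk (MulAction.orbitRel G X) x

variable (X) in
theorem quo_surjective : Function.Surjective (quo G (X := X)) := Quotient.mk_surjective

theorem quo_eq_quo {x y : X} : quo G x = quo G y ↔ ∃ g : G, g • y = x :=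
  Quotient.eq''.trans MulAction.orbitRel_apply

@[simp] theorem quo_smul (g : G) (x : X) : quo G (g • x) = quo G x :=
  (quo_eq_quo G).2 ⟨g, rfl⟩

variable [TopologicalSpace X] [ChartedSpace H X] [T2Space X] [LocallyCompactSpace X]
  [Finite G] [ContinuousConstSMul G X] [IsCancelSMul G X]

variable (X) in
theorem quo_isLocalHomeomorph : IsLocalHomeomorph (quo G (X := X)) :=
  isQuotientCoveringMap_quotientMk_of_properlyDiscontinuousSMul.isCoveringMap.isLocalHomeomorph

/-- The local inverse of the quotient map near `quo x`. -/
noncomputable def lsec (x : X) : OpenPartialHomeomorph (MulAction.orbitRel.Quotient G X) X :=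
  (quo_isLocalHomeomorph G X).localInverseAt x

theorem quo_lsec {x : X} {q : MulAction.orbitRel.Quotient G X} (hq : q ∈ (lsec G x).source) :
    quo G (lsec G x q) = q := (quo_isLocalHomeomorph G X).apply_localInverseAt_of_mem hq

theorem lsec_symm (x : X) : ((lsec G x).symm : X → _) = quo G :=
  (quo_isLocalHomeomorph G X).localInverseAt_symm x

theorem lsec_quo_self (x : X) : lsec G x (quo G x) = x :=
  (quo_isLocalHomeomorph G X).localInverseAt_apply_self

theorem mem_lsec_source (x : X) : quo G x ∈ (lsec G x).source :=
  (quo_isLocalHomeomorph G X).apply_self_mem_localInverseAt_source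

/-- A local inverse of the quotient map, composed with the quotient map, is locally the action of
an element of the group. -/
theorem lsec_quo_eventuallyEq (a y : X) (hy : quo G y ∈ (lsec G a).source) :
    ∃ g : G, (fun z ↦ lsec G a (quo G z)) =ᶠ[𝓝 y] fun z ↦ g • z := by
  obtain ⟨g, hg⟩ := (quo_eq_quo G).1 (quo_lsec G hy)
  refine ⟨g, ?_⟩
  have h1 : ∀ᶠ z in 𝓝 y, g • z ∈ (lsec G a).target := by
    apply (continuous_const_smul g).continuousAt.eventually_mem
    apply (lsec G a).open_target.mem_nhds
    rw [hg]
    exact (lsec G a).map_source hy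
  filter_upwards [h1] with z hz
  have := (lsec G a).right_inv hz
  rwa [lsec_symm, quo_smul] at this

theorem exists_chartAt_eq (q : MulAction.orbitRel.Quotient G X) :
    ∃ a : X, chartAt H q = (lsec G a).trans (chartAt H a) := ⟨_, rfl⟩

theorem exists_eq_of_mem_atlas (e : OpenPartialHomeomorph (MulAction.orbitRel.Quotient G X) H)
    (he : e ∈ atlas H (MulAction.orbitRel.Quotient G X)) :
    ∃ a : X, e = (lsec G a).trans (chartAt H a) := by
  obtain ⟨q, rfl⟩ := he
  exact ⟨_, rfl⟩

variable [IsManifold I ∞ X]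

/-- The quotient of a smooth manifold by a free smooth action of a finite group is a smooth
manifold. -/
theorem isManifold_quotient (hG : ∀ g : G, ContMDiff I I ∞ (fun x : X ↦ g • x)) :
    IsManifold I ∞ (MulAction.orbitRel.Quotient G X) := by
  apply isManifold_of_contDiffOn
  intro e e' he he'
  obtain ⟨a, rfl⟩ := exists_eq_of_mem_atlas G e he
  obtain ⟨b, rfl⟩ := exists_eq_of_mem_atlas G e' he'
  rintro z ⟨hz, hzr⟩
  simp only [OpenPartialHomeomorph.trans_source, OpenPartialHomeomorph.symm_source,
    OpenPartialHomeomorph.trans_target, OpenPartialHomeomorph.coe_trans_symm,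
    mem_preimage, mem_inter_iff, Function.comp_apply, lsec_symm] at hz
  obtain ⟨⟨hz1, hz2⟩, hz3, hz4⟩ := hz
  set y : X := (chartAt H a).symm (I.symm z) with hy
  obtain ⟨g, hg⟩ := lsec_quo_eventuallyEq G b y hz3
  have hzt : z ∈ (extChartAt I a).target := by
    rw [extChartAt_target]
    exact ⟨hz1, hzr⟩
  have hs : ContMDiffWithinAt 𝓘(ℝ, E) I ∞ (extChartAt I a).symm (range I) z :=
    contMDiffWithinAt_extChartAt_symm_range a hzt
  have hgy : g • y = lsec G b (quo G y) := hg.self_of_nhds.symm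
  have hc : ContMDiffAt I 𝓘(ℝ, E) ∞ (extChartAt I b) (g • y) :=
    contMDiffAt_extChartAt' (by rw [hgy]; exact hz4)
  have hyz : (extChartAt I a).symm z = y := by simp [hy]
  have hcomp : ContMDiffWithinAt 𝓘(ℝ, E) 𝓘(ℝ, E) ∞
      ((fun w : X ↦ extChartAt I b (g • w)) ∘ (extChartAt I a).symm) (range I) z := by
    refine ContMDiffAt.comp_contMDiffWithinAt z ?_ hs
    rw [hyz]
    exact ContMDiffAt.comp y hc (hG g).contMDiffAt
  have hcd := hcomp.contDiffWithinAt
  refine (hcd.mono inter_subset_right).congr_of_eventuallyEq ?_ ?_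
  · have hcont : ContinuousWithinAt (extChartAt I a).symm (range I) z := hs.continuousWithinAt
    have : ∀ᶠ w in 𝓝[range I] z, lsec G b (quo G ((extChartAt I a).symm w))
        = g • (extChartAt I a).symm w := by
      have := hcont.tendsto
      rw [hyz] at this
      exact this.eventually hg
    filter_upwards [nhdsWithin_mono z inter_subset_right this] with w hw
    simp only [extChartAt_coe_symm, Function.comp_apply] at hw
    simp [lsec_symm, ← hw]
  · have := hg.self_of_nhds
    simp only at this
    simp [lsec_symm, ← hy, ← this]

theorem contMDiffAt_lsec (hG : ∀ g : G, ContMDiff I I ∞ (fun x : X ↦ g • x)) (a : X)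
    {q : MulAction.orbitRel.Quotient G X} (hq : q ∈ (lsec G a).source) :
    ContMDiffAt I I ∞ (lsec G a) q := by
  have := isManifold_quotient I G hG
  obtain ⟨b, hb⟩ := exists_chartAt_eq (H := H) G q
  have hqb : q ∈ (lsec G b).source ∧ lsec G b q ∈ (chartAt H b).source := by
    have := mem_chart_source H q
    rw [hb] at this
    simpa using this
  -- the local inverse at `b` is smooth near `q`, since it is a chart of the base followed by
  -- the inverse of a chart of the total space
  have h1 : ContMDiffAt I I ∞ (lsec G b) q := by
    have hc : ContMDiffAt I I ∞ (chartAt H q) q :=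
      contMDiffOn_chart.contMDiffAt ((chartAt H q).open_source.mem_nhds (mem_chart_source H q))
    have hct : chartAt H q q ∈ (chartAt H b).target := by
      rw [hb]
      exact (chartAt H b).map_source hqb.2
    have hc' : ContMDiffAt I I ∞ (chartAt H b).symm (chartAt H q q) :=
      contMDiffOn_chart_symm.contMDiffAt ((chartAt H b).open_target.mem_nhds hct)
    refine (hc'.comp q hc).congr_of_eventuallyEq ?_
    filter_upwards [(chartAt H q).open_source.mem_nhds (mem_chart_source H q)] with w hw
    rw [hb] at hw ⊢
    simp only [OpenPartialHomeomorph.trans_source, mem_inter_iff, mem_preimage] at hw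
    simp [(chartAt H b).left_inv hw.2]
  obtain ⟨g, hg⟩ := lsec_quo_eventuallyEq G a (lsec G b q) (by rwa [quo_lsec G hqb.1])
  refine (((hG g).contMDiffAt).comp q h1).congr_of_eventuallyEq ?_
  filter_upwards [((lsec G b).continuousAt hqb.1).eventually hg,
    (lsec G b).open_source.mem_nhds hqb.1] with w hw hw'
  simpa [quo_lsec G hw'] using hw

theorem contMDiff_quo (hG : ∀ g : G, ContMDiff I I ∞ (fun x : X ↦ g • x)) :
    ContMDiff I I ∞ (quo G (X := X)) := by
  intro x
  rw [contMDiffAt_iff_target]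
  refine ⟨(quo_isLocalHomeomorph G X).continuous.continuousAt, ?_⟩
  obtain ⟨b, hb⟩ := exists_chartAt_eq (H := H) G (quo G x)
  have hqb : quo G x ∈ (lsec G b).source ∧ lsec G b (quo G x) ∈ (chartAt H b).source := by
    have := mem_chart_source H (quo G x)
    rw [hb] at this
    simpa using this
  obtain ⟨g, hg⟩ := lsec_quo_eventuallyEq G b x hqb.1
  have hc : ContMDiffAt I 𝓘(ℝ, E) ∞ (extChartAt I b) (g • x) :=
    contMDiffAt_extChartAt' (by have := hg.self_of_nhds; simp only at this; rw [← this]; exact hqb.2)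
  refine (ContMDiffAt.comp x hc (hG g).contMDiffAt).congr_of_eventuallyEq ?_
  filter_upwards [hg] with w hw
  simp [extChartAt, hb, hw]

/-- The quotient map is a local diffeomorphism. -/
theorem isLocalDiffeomorph_quo (hG : ∀ g : G, ContMDiff I I ∞ (fun x : X ↦ g • x)) :
    IsLocalDiffeomorph I I ∞ (quo G (X := X)) := by
  intro x
  refine ⟨⟨(lsec G x).symm.toPartialEquiv, (lsec G x).open_target, (lsec G x).open_source,
    ?_, ?_⟩, ?_, ?_⟩
  · have := (contMDiff_quo I G hG).contMDiffOn (s := (lsec G x).target)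
    rwa [← lsec_symm G x] at this
  · exact fun q hq ↦ (contMDiffAt_lsec I G hG x hq).contMDiffWithinAt
  · have := (lsec G x).map_source (mem_lsec_source G x)
    rwa [lsec_quo_self] at this
  · intro y _
    change quo G y = (lsec G x).symm y
    rw [lsec_symm]

end Quotient

section Metric

variable {E : Type*} [NormedAddCommGroup E] [NormedSpace ℝ E]
  {H : Type*} [TopologicalSpace H] (I : ModelWithCorners ℝ E H)
  (G : Type*) [Group G] (X : Type*) [TopologicalSpace X] [ChartedSpace H X] [IsManifold I ∞ X]
  [RiemannianBundle (fun x : X ↦ TangentSpace I x)] [MulAction G X]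

/-- The group `G` acts on the Riemannian manifold `X` by smooth isometries, i.e. by smooth maps
that preserve the Riemannian metric. -/
class IsRiemannianAction : Prop where
  contMDiff_smul (h : G) : ContMDiff I I ∞ (fun x : X ↦ h • x)
  inner_mfderiv_smul (h : G) (x : X) (v w : TangentSpace I x) :
    inner ℝ (mfderiv I I (fun x : X ↦ h • x) x v) (mfderiv I I (fun x : X ↦ h • x) x w) =
      inner ℝ v w

variable [T2Space X] [LocallyCompactSpace X]
  [Finite G] [ContinuousConstSMul G X] [IsCancelSMul G X] [IsRiemannianAction I G X]

instance instIsManifoldQuotient : IsManifold I ∞ (MulAction.orbitRel.Quotient G X) :=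
  isManifold_quotient I G IsRiemannianAction.contMDiff_smul

variable {X}

theorem isInvertible_mfderiv_quo (x : X) : (mfderiv I I (quo G) x).IsInvertible :=
  ⟨_, (isLocalDiffeomorph_quo I G IsRiemannianAction.contMDiff_smul
    x).mfderivToContinuousLinearEquiv_coe (by simp)⟩

/-- The inner product on the tangent space of the quotient at `quo x` for which the differential of
the quotient map at `x` is a linear isometry. -/
noncomputable def pushInner (x : X) :
    TangentSpace I (quo G x) →L[ℝ] TangentSpace I (quo G x) →L[ℝ] ℝ :=
  (ContinuousLinearMap.precomp ℝ (mfderiv I I (quo G) x).inverse).comp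
    ((innerSL ℝ (E := TangentSpace I x)).comp (mfderiv I I (quo G) x).inverse)

theorem pushInner_apply (x : X) (v w : TangentSpace I (quo G x)) :
    pushInner I G x v w =
      inner ℝ ((mfderiv I I (quo G) x).inverse v) ((mfderiv I I (quo G) x).inverse w) := rfl

theorem pushInner_mfderiv_self (x : X) (v w : TangentSpace I x) :
    pushInner I G x (mfderiv I I (quo G) x v) (mfderiv I I (quo G) x w) = inner ℝ v w := by
  obtain ⟨e, he⟩ := isInvertible_mfderiv_quo I G x
  rw [pushInner_apply, ← he, ContinuousLinearMap.inverse_equiv]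
  simp

theorem isVonNBounded_pushInner (x : X) :
    Bornology.IsVonNBounded ℝ {v : TangentSpace I (quo G x) | pushInner I G x v v < 1} := by
  obtain ⟨e, he⟩ := isInvertible_mfderiv_quo I G x
  have h1 : Bornology.IsVonNBounded ℝ (Metric.ball (0 : TangentSpace I x) 1) :=
    NormedSpace.isVonNBounded_ball ℝ _ 1
  refine (h1.image (e : TangentSpace I x →L[ℝ] TangentSpace I (quo G x))).subset ?_
  intro v hv
  refine ⟨e.symm v, ?_, by simp⟩
  simp only [mem_ofPred_eq, pushInner_apply, ← he, ContinuousLinearMap.inverse_equiv,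
    ContinuousLinearEquiv.coe_coe, real_inner_self_eq_norm_sq] at hv
  rw [mem_ball_zero_iff]
  nlinarith [norm_nonneg (e.symm v)]

theorem pushInner_pos (x : X) (v : TangentSpace I (quo G x)) (hv : v ≠ 0) :
    0 < pushInner I G x v v := by
  obtain ⟨e, he⟩ := isInvertible_mfderiv_quo I G x
  rw [pushInner_apply, ← he, ContinuousLinearMap.inverse_equiv]
  exact real_inner_self_pos.2 (by simpa using hv)

theorem pushInner_symm (x : X) (v w : TangentSpace I (quo G x)) :
    pushInner I G x v w = pushInner I G x w v := by
  rw [pushInner_apply, pushInner_apply, real_inner_comm]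

theorem continuousAt_pushInner (x : X) :
    ContinuousAt (fun v : TangentSpace I (quo G x) ↦ pushInner I G x v v) 0 := by
  simp only [pushInner_apply]
  exact (Continuous.inner (ContinuousLinearMap.continuous _)
    (ContinuousLinearMap.continuous _)).continuousAt

variable (X)

/-- The Riemannian metric on the quotient induced from the one on `X`: on the tangent space at `q`,
it is the inner product for which the differential of the quotient map at a point over `q` is
a linear isometry. The choice of this point does not matter, see `inner_mfderiv_quo`. -/
noncomputable def quotientMetric :
    RiemannianMetric (fun q : MulAction.orbitRel.Quotient G X ↦ TangentSpace I q) where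
  inner q := pushInner I G q.out
  symm q := pushInner_symm I G q.out
  pos q := pushInner_pos I G q.out
  continuousAt q := continuousAt_pushInner I G q.out
  isVonNBounded q := isVonNBounded_pushInner I G q.out

noncomputable instance instRiemannianBundleQuotient :
    RiemannianBundle (fun q : MulAction.orbitRel.Quotient G X ↦ TangentSpace I q) :=
  ⟨quotientMetric I G X⟩

variable {X}

theorem mfderiv_quo_smul (g : G) (x : X) (v : TangentSpace I x) :
    mfderiv I I (quo G) (g • x) (mfderiv I I (fun x : X ↦ g • x) x v) =
      (mfderiv I I (quo G) x v : E) := by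
  have h1 : MDifferentiableAt I I (fun x : X ↦ g • x) x :=
    (IsRiemannianAction.contMDiff_smul (I := I) g).mdifferentiable (by simp) x
  have h2 : MDifferentiableAt I I (quo G) (g • x) :=
    (contMDiff_quo I G IsRiemannianAction.contMDiff_smul).mdifferentiable (by simp) (g • x)
  have h3 : (quo G ∘ fun x : X ↦ g • x) = quo G := by ext; simp
  have h4 := mfderiv_comp x h2 h1
  rw [h3] at h4
  rw [h4]
  rfl

/-- The quotient map is a local isometry. -/
theorem inner_mfderiv_quo (x : X) (v w : TangentSpace I x) :
    inner ℝ (mfderiv I I (quo G) x v) (mfderiv I I (quo G) x w) = inner ℝ v w := by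
  have key : ∀ y : X, quo G y = quo G x →
      pushInner I G y (mfderiv I I (quo G) x v : E) (mfderiv I I (quo G) x w : E) =
        inner ℝ v w := by
    intro y hy
    obtain ⟨g, rfl⟩ := (quo_eq_quo G).1 hy
    rw [← mfderiv_quo_smul I G g x v, ← mfderiv_quo_smul I G g x w]
    exact (pushInner_mfderiv_self I G (g • x) _ _).trans
      (IsRiemannianAction.inner_mfderiv_smul g x v w)
  exact key _ (Quotient.out_eq (quo G x))

theorem inner_quotient_eq (a : X) {q : MulAction.orbitRel.Quotient G X}
    (hq : q ∈ (lsec G a).source) (v w : TangentSpace I q) :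
    inner ℝ v w = inner ℝ (mfderiv I I (lsec G a) q v) (mfderiv I I (lsec G a) q w) := by
  have h1 : MDifferentiableAt I I (lsec G a) q :=
    (contMDiffAt_lsec I G IsRiemannianAction.contMDiff_smul a hq).mdifferentiableAt (by simp)
  have h2 : MDifferentiableAt I I (quo G) (lsec G a q) :=
    (contMDiff_quo I G IsRiemannianAction.contMDiff_smul).mdifferentiable (by simp) _
  have h3 : (quo G ∘ lsec G a) =ᶠ[𝓝 q] id := by
    filter_upwards [(lsec G a).open_source.mem_nhds hq] with r hr
    exact quo_lsec G hr
  have h4 : ∀ u : TangentSpace I q,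
      mfderiv I I (quo G) (lsec G a q) (mfderiv I I (lsec G a) q u) = (u : E) := by
    intro u
    have := mfderiv_comp q h2 h1
    rw [h3.mfderiv_eq, mfderiv_id] at this
    exact (DFunLike.congr_fun this u).symm
  refine Eq.trans ?_ (inner_mfderiv_quo I G (lsec G a q) _ _)
  have key : ∀ (r : MulAction.orbitRel.Quotient G X), r = q → ∀ (v' w' : TangentSpace I r),
      (v' : E) = v → (w' : E) = w → inner ℝ v w = inner ℝ v' w' := by
    rintro r rfl v' w' rfl rfl
    rfl
  exact key _ (quo_lsec G hq) _ _ (h4 v) (h4 w)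

/-- The induced Riemannian metric on the quotient is smooth. -/
instance instIsContMDiffRiemannianBundleQuotient
    [h : IsContMDiffRiemannianBundle I ∞ E (fun x : X ↦ TangentSpace I x)] :
    IsContMDiffRiemannianBundle I ∞ E
      (fun q : MulAction.orbitRel.Quotient G X ↦ TangentSpace I q) := by
  obtain ⟨g, hg, hgi⟩ := h.exists_contMDiff
  refine ⟨(quotientMetric I G X).inner, fun q₀ ↦ ?_, fun _ _ _ ↦ rfl⟩
  set γ := (quotientMetric I G X).inner with hγ
  obtain ⟨a, rfl⟩ := quo_surjective G X q₀
  have hs := contMDiffAt_lsec I G IsRiemannianAction.contMDiff_smul a (mem_lsec_source G a)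
  have hsa : lsec G a (quo G a) = a := lsec_quo_self G a
  rw [contMDiffAt_hom_bundle]
  refine ⟨contMDiffAt_id, ?_⟩
  have hG := (contMDiffAt_hom_bundle _).1 (hg.contMDiffAt (x := a)) |>.2
  have hA := hs.mfderiv_const (m := ∞) (by simp)
  rw [← hsa] at hG
  have hGs := hG.comp (quo G a) hs
  set A := inTangentCoordinates I I id (lsec G a) (mfderiv I I (lsec G a)) (quo G a)
  refine ((hA.clm_precomp (F₃ := ℝ)).clm_comp (hGs.clm_comp hA)).congr_of_eventuallyEq ?_
  have hU : ∀ᶠ q in 𝓝 (quo G a), q ∈ (lsec G a).source :=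
    (lsec G a).open_source.mem_nhds (mem_lsec_source G a)
  have hV : ∀ᶠ q in 𝓝 (quo G a),
      q ∈ (trivializationAt E (TangentSpace I (M := MulAction.orbitRel.Quotient G X))
        (quo G a)).baseSet :=
    (trivializationAt E (TangentSpace I) (quo G a)).open_baseSet.mem_nhds
      (FiberBundle.mem_baseSet_trivializationAt' _)
  have hW : ∀ᶠ q in 𝓝 (quo G a), lsec G a q ∈
      (trivializationAt E (TangentSpace I (M := X)) (lsec G a (quo G a))).baseSet :=
    hs.continuousAt.eventually_mem
      ((trivializationAt E (TangentSpace I) (lsec G a (quo G a))).open_baseSet.mem_nhds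
        (FiberBundle.mem_baseSet_trivializationAt' _))
  filter_upwards [hU, hV, hW] with q hq hqV hqW
  have hAq : ∀ u : E, (trivializationAt E (TangentSpace I) (lsec G a (quo G a))).symm
      (lsec G a q) (A q u) = mfderiv I I (lsec G a) q
        ((trivializationAt E (TangentSpace I) (quo G a)).symm q u) := by
    intro u
    have h1 : A q u = (trivializationAt E (TangentSpace I)
        (lsec G a (quo G a))).continuousLinearEquivAt ℝ (lsec G a q) hqW (mfderiv I I (lsec G a) q
        ((trivializationAt E (TangentSpace I) (quo G a)).symm q u)) := by
      exact DFunLike.congr_fun (ContinuousLinearMap.inCoordinates_eq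
        (ϕ := mfderiv I I (lsec G a) q) hqV hqW) u
    rw [h1]
    exact ((trivializationAt E (TangentSpace I)
      (lsec G a (quo G a))).continuousLinearEquivAt ℝ (lsec G a q) hqW).symm_apply_apply _
  ext v w
  refine (inCoordinates_apply_eq₂ (E₃ := fun _ ↦ ℝ) hqV hqV (mem_univ _)).trans ?_
  refine Eq.trans ?_ (inCoordinates_apply_eq₂ (E₃ := fun _ ↦ ℝ) (v := A q v) (w := A q w)
    hqW hqW (mem_univ _)).symm
  rw [hAq, hAq, ← hgi, ← inner_quotient_eq I G a hq]
  rfl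

end Metric

section FrechetMean

/-- The Fréchet mean set of a measure `μ` on a Riemannian manifold: the set of minimizers of
`p ↦ ∫ d(x, p)² dμ(x)`, where `d` is the Riemannian distance. -/
def frechetMeanSet {E : Type*} [NormedAddCommGroup E] [NormedSpace ℝ E]
    {H : Type*} [TopologicalSpace H] (I : ModelWithCorners ℝ E H)
    {M : Type*} [TopologicalSpace M] [ChartedSpace H M] [MeasurableSpace M]
    [RiemannianBundle (fun x : M ↦ TangentSpace I x)] (μ : Measure M) : Set M :=
  {p | ∀ p' : M, ∫⁻ x, riemannianEDist I x p ^ 2 ∂μ ≤ ∫⁻ x, riemannianEDist I x p' ^ 2 ∂μ}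

/-- The empirical measure `(1/N) ∑ δ_{q_i}` of a configuration `Q = (q_1, …, q_N)`. -/
noncomputable def empiricalMeasure {M : Type*} [MeasurableSpace M] {N : ℕ} (Q : Fin N → M) :
    Measure M :=
  (N : ℝ≥0∞)⁻¹ • ∑ i, Measure.dirac (Q i)

/-- The Fréchet mean set `FM(Q)` of a configuration `Q`. -/
noncomputable def FM {E : Type*} [NormedAddCommGroup E] [NormedSpace ℝ E]
    {H : Type*} [TopologicalSpace H] (I : ModelWithCorners ℝ E H)
    {M : Type*} [TopologicalSpace M] [ChartedSpace H M] [MeasurableSpace M]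
    [RiemannianBundle (fun x : M ↦ TangentSpace I x)] {N : ℕ} (Q : Fin N → M) : Set M :=
  frechetMeanSet I (empiricalMeasure Q)

variable (G : Type*) [Group G] {X : Type*} [EMetricSpace X] [MulAction G X]

/-- The equivariant distance `d̃(quo⁻¹(q), p)` between a point `q` of the quotient and a point `p` of
the total space. -/
noncomputable def equivariantDist (q : MulAction.orbitRel.Quotient G X) (p : X) : ℝ≥0∞ :=
  Metric.infEDist p (quo G ⁻¹' {q})

/-- The equivariant Fréchet function of a configuration `Q` in the quotient. -/
noncomputable def equivariantFrechetFun {N : ℕ} (Q : Fin N → MulAction.orbitRel.Quotient G X)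
    (p : X) : ℝ≥0∞ :=
  (N : ℝ≥0∞)⁻¹ * ∑ i, equivariantDist G (Q i) p ^ 2

/-- The set `EFM(Q)` of equivariant Fréchet means of a configuration `Q` in the quotient. -/
def EFM {N : ℕ} (Q : Fin N → MulAction.orbitRel.Quotient G X) : Set X :=
  {p | ∀ p' : X, equivariantFrechetFun G Q p ≤ equivariantFrechetFun G Q p'}

/-- Any two equivariant Fréchet means of `Q` are related by the action of an element of `G`. -/
def EFMUniqueUpToAction {N : ℕ} (Q : Fin N → MulAction.orbitRel.Quotient G X) : Prop :=
  ∀ p ∈ EFM G Q, ∀ p' ∈ EFM G Q, ∃ h : G, h • p = p'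

end FrechetMean

end EquivariantMean

/-! The Riemannian distance of the quotient is the distance between fibres (`riemannianEDist_quo`):
`quo` preserves the speed of paths, so a path upstairs projects to one of equal length, and, `quo`
being a covering, a path downstairs lifts from any point over its start to one of equal length.
Hence the Fréchet function pulled back along `quo` is exactly the equivariant Fréchet function
(`lintegral_riemannianEDist_quo`). As `quo` is surjective, minimizers upstairs are precisely the
points over minimizers downstairs, and everything except the complete case is then a formal
consequence of the fibres being orbits.

In the complete case it remains to see that minimizers exist (`EFM_nonempty`). By Hopf–Rinow closed
balls of finite radius are compact. A finite sublevel set of the Fréchet function lies in a finite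
union of such balls, centred on one orbit, so the continuous function attains its minimum there. -/

namespace EquivariantMean

/-! ### Hopf–Rinow–Cohn-Vossen for length spaces, with infinite distances allowed. -/

section LengthSpace

open scoped NNReal

/-- An extended metric space in which, up to arbitrarily small errors, any two points at finite
distance have points in between at prescribed distances. -/
def HasIntermediatePoints (X : Type*) [PseudoEMetricSpace X] : Prop :=
  ∀ (x y : X) (r : ℝ≥0) (s : ℝ≥0∞), 0 < s → edist x y < r + s → ∃ z, edist x z ≤ r ∧ edist z y < s

variable {X : Type*} [EMetricSpace X]

/-- A slightly smaller concentric ball is compact, hence has a finite net, and intermediate points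
show that every point of the large ball is close to the small one, so the same net serves with a
coarser mesh. -/
theorem HasIntermediatePoints.totallyBounded_closedEBall (h : HasIntermediatePoints X) {x : X}
    {r : ℝ≥0} (hr : ∀ r' < r, IsCompact (Metric.closedEBall x (r' : ℝ≥0∞))) :
    TotallyBounded (Metric.closedEBall x (r : ℝ≥0∞)) := by
  rcases eq_zero_or_pos r with rfl | hr0
  · simp [Metric.closedEBall_zero, totallyBounded_singleton]
  rw [EMetric.totallyBounded_iff]
  intro ε hε
  -- The radius shrinks by `η` and the net has mesh `η`. Having `2η < ε` leaves `ε - η > η`, the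
  -- strict slack demanded by the intermediate point property.
  obtain ⟨η, hη0, hηε⟩ : ∃ η : ℝ≥0, 0 < η ∧ (η : ℝ≥0∞) + η < ε := by
    obtain ⟨η, hη0, hη⟩ := ENNReal.lt_iff_exists_nnreal_btwn.1 hε
    refine ⟨η / 2, by simpa using hη0, ?_⟩
    rw [← ENNReal.coe_add, add_halves]
    exact hη
  have hlt : r - η < r := tsub_lt_self hr0 hη0
  obtain ⟨t, ht, hcover⟩ := EMetric.totallyBounded_iff.1 (hr _ hlt).totallyBounded η
    (by simpa using hη0)
  refine ⟨t, ht, fun y hy ↦ ?_⟩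
  have hxy : edist x y < ((r - η : ℝ≥0) : ℝ≥0∞) + (ε - η) := by
    rw [Metric.mem_closedEBall'] at hy
    have h1 : (η : ℝ≥0∞) < ε - η := lt_tsub_iff_right.2 hηε
    have h2 : (r : ℝ≥0∞) ≤ ((r - η : ℝ≥0) : ℝ≥0∞) + η := by
      exact_mod_cast le_tsub_add
    exact (hy.trans h2).trans_lt (ENNReal.add_lt_add_left ENNReal.coe_ne_top h1)
  obtain ⟨z, hz, hzy⟩ := h x y _ _ (tsub_pos_iff_lt.2 (le_add_self.trans_lt hηε)) hxy
  obtain ⟨w, hw, hzw⟩ := mem_iUnion₂.1 (hcover (Metric.mem_closedEBall'.2 hz))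
  refine mem_iUnion₂.2 ⟨w, hw, ?_⟩
  rw [Metric.mem_eball] at hzw ⊢
  rw [edist_comm z y, lt_tsub_iff_right] at hzy
  exact (edist_triangle y z w).trans_lt
    ((add_le_add_right hzw.le _).trans_lt hzy)

/-- The Hopf–Rinow–Cohn-Vossen theorem: in a complete locally compact length space, closed balls of
finite radius are compact. -/
theorem HasIntermediatePoints.isCompact_closedEBall [LocallyCompactSpace X] [CompleteSpace X]
    (h : HasIntermediatePoints X) (x : X) (r : ℝ≥0) :
    IsCompact (Metric.closedEBall x (r : ℝ≥0∞)) := by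
  by_contra hr
  -- Continuity argument on the infimum of the bad radii: the ball at the infimum is totally bounded
  -- and complete, hence compact. Local compactness gives it a compact thickening, which contains
  -- all balls of slightly larger radius, so the infimum could be raised.
  set S : Set ℝ≥0 := {r | ¬ IsCompact (Metric.closedEBall x (r : ℝ≥0∞))} with hS
  have hne : S.Nonempty := ⟨r, hr⟩
  have hlt : ∀ r' < sInf S, IsCompact (Metric.closedEBall x (r' : ℝ≥0∞)) := fun r' hr' ↦ by
    by_contra hc
    exact (csInf_le (OrderBot.bddBelow S) hc).not_gt hr'
  have hK : IsCompact (Metric.closedEBall x ((sInf S : ℝ≥0) : ℝ≥0∞)) :=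
    isCompact_iff_totallyBounded_isComplete.2
      ⟨h.totallyBounded_closedEBall hlt, Metric.isClosed_closedEBall.isComplete⟩
  obtain ⟨δ, hδ0, hδ⟩ := hK.exists_isCompact_cthickening
  lift δ to ℝ≥0 using hδ0.le
  replace hδ0 : 0 < δ := by exact_mod_cast hδ0
  have hsub : ∀ r' : ℝ≥0, r' < sInf S + δ →
      Metric.closedEBall x (r' : ℝ≥0∞) ⊆ Metric.cthickening δ
        (Metric.closedEBall x ((sInf S : ℝ≥0) : ℝ≥0∞)) := by
    intro r' hr' y hy
    rw [Metric.mem_closedEBall'] at hy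
    obtain ⟨z, hz, hzy⟩ := h x y (sInf S) δ (by simpa using hδ0) (hy.trans_lt (by exact_mod_cast hr'))
    refine Metric.thickening_subset_cthickening _ _
      ((Metric.mem_thickening_iff_exists_edist_lt _ _).2 ⟨z, Metric.mem_closedEBall'.2 hz, ?_⟩)
    rw [edist_comm]
    simpa using hzy
  have hle : sInf S + δ ≤ sInf S := le_csInf hne fun r' hr' ↦ by
    by_contra hc
    exact hr' (hδ.of_isClosed_subset Metric.isClosed_closedEBall (hsub r' (not_le.1 hc)))
  exact absurd hle (not_le.2 (lt_add_of_pos_right _ hδ0))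

/-- Along a path of length less than `r + s`, the distance from `x` is continuous, so some point is
at distance exactly `r`. The path up to it has length at least `r`, leaving less than `s` for the
rest. -/
theorem _root_.IsRiemannianManifold.hasIntermediatePoints
    {E : Type*} [NormedAddCommGroup E] [NormedSpace ℝ E]
    {H : Type*} [TopologicalSpace H] (I : ModelWithCorners ℝ E H)
    [ChartedSpace H X] [RiemannianBundle (fun x : X ↦ TangentSpace I x)]
    [IsRiemannianManifold I X] : HasIntermediatePoints X := by
  intro x y r s hs hxy
  rcases le_or_gt (edist x y) r with hr | hr
  · exact ⟨y, hr, by rwa [edist_self]⟩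
  rw [IsRiemannianManifold.out (I := I) x y] at hxy
  obtain ⟨γ, hγ0, hγ1, hγ, hlen⟩ := exists_lt_of_riemannianEDist_lt hxy
  have hcont : ContinuousOn (fun t ↦ edist x (γ t)) (Icc 0 1) := by
    have : ContinuousOn γ (Icc 0 1) := hγ.continuousOn
    fun_prop
  obtain ⟨t, ht, htr⟩ := intermediate_value_Icc zero_le_one hcont
    (show (r : ℝ≥0∞) ∈ Icc (edist x (γ 0)) (edist x (γ 1)) by simp [hγ0, hγ1, hr.le])
  simp only at htr
  refine ⟨γ t, htr.le, ?_⟩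
  rw [← pathELength_add ht.1 ht.2] at hlen
  have h1 : (r : ℝ≥0∞) ≤ pathELength I γ 0 t := by
    rw [← htr, IsRiemannianManifold.out (I := I) x (γ t)]
    exact riemannianEDist_le_pathELength (hγ.mono (Icc_subset_Icc_right ht.2)) hγ0 rfl ht.1
  have h2 : edist (γ t) y ≤ pathELength I γ t 1 := by
    rw [IsRiemannianManifold.out (I := I) (γ t) y]
    exact riemannianEDist_le_pathELength (hγ.mono (Icc_subset_Icc_left ht.1)) rfl hγ1 ht.2
  have h3 : (r : ℝ≥0∞) + pathELength I γ t 1 < r + s := (add_le_add_left h1 _).trans_lt hlen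
  exact h2.trans_lt ((ENNReal.add_lt_add_iff_left ENNReal.coe_ne_top).1 h3)

end LengthSpace

/-! ### Projecting and lifting paths along the quotient map. -/

section QuotientDistance

variable {E : Type*} [NormedAddCommGroup E] [NormedSpace ℝ E]
  {H : Type*} [TopologicalSpace H] (I : ModelWithCorners ℝ E H)
  (G : Type*) [Group G] {X : Type*} [TopologicalSpace X] [ChartedSpace H X] [IsManifold I ∞ X]
  [RiemannianBundle (fun x : X ↦ TangentSpace I x)] [MulAction G X]
  [T2Space X] [LocallyCompactSpace X]
  [Finite G] [ContinuousConstSMul G X] [IsCancelSMul G X] [IsRiemannianAction I G X]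

theorem enorm_mfderiv_quo (x : X) (v : TangentSpace I x) :
    ‖mfderiv I I (quo G) x v‖ₑ = ‖v‖ₑ := by
  have h : ‖mfderiv I I (quo G) x v‖ = ‖v‖ := by
    rw [norm_eq_sqrt_real_inner, norm_eq_sqrt_real_inner, inner_mfderiv_quo]
  rw [← ofReal_norm, ← ofReal_norm, h]

/-- The quotient map preserves the speed of differentiable paths. -/
theorem enorm_mfderiv_quo_comp {γ : unitInterval → X} {t : unitInterval}
    (hγ : MDifferentiableAt (𝓡∂ 1) I γ t) :
    ‖mfderiv (𝓡∂ 1) I (quo G ∘ γ) t 1‖ₑ = ‖mfderiv (𝓡∂ 1) I γ t 1‖ₑ := by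
  have h2 : MDifferentiableAt I I (quo G) (γ t) :=
    (contMDiff_quo I G IsRiemannianAction.contMDiff_smul).mdifferentiable (by simp) _
  rw [mfderiv_comp t h2 hγ]
  exact enorm_mfderiv_quo I G (γ t) _

theorem riemannianEDist_quo_le (x y : X) :
    riemannianEDist I (quo G x) (quo G y) ≤ riemannianEDist I x y := by
  simp only [riemannianEDist, le_iInf_iff]
  intro γ hγ
  have hq : ContMDiff I I 1 (quo G (X := X)) :=
    (contMDiff_quo I G IsRiemannianAction.contMDiff_smul).of_le (by simp)
  refine (iInf₂_le (γ.map hq.continuous) (hq.comp hγ)).trans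
    (lintegral_mono fun t ↦ (enorm_mfderiv_quo_comp I G ?_).le)
  exact hγ.mdifferentiable (by simp) t

/-- A continuous lift of a smooth path in the quotient is smooth. -/
theorem contMDiff_of_quo_comp {γ : unitInterval → X} (hγ : Continuous γ)
    (h : ContMDiff (𝓡∂ 1) I 1 (quo G ∘ γ)) : ContMDiff (𝓡∂ 1) I 1 γ := by
  intro t
  have hs : ContMDiffAt I I 1 (lsec G (γ t)) (quo G (γ t)) :=
    (contMDiffAt_lsec I G IsRiemannianAction.contMDiff_smul (γ t)
      (mem_lsec_source G (γ t))).of_le (by simp)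
  refine (hs.comp t (h t)).congr_of_eventuallyEq ?_
  have hmem : γ t ∈ (lsec G (γ t)).target := by
    simpa [lsec_quo_self] using (lsec G (γ t)).map_source (mem_lsec_source G (γ t))
  filter_upwards [hγ.continuousAt.eventually_mem ((lsec G (γ t)).open_target.mem_nhds hmem)]
    with s hs'
  simpa [lsec_symm] using ((lsec G (γ t)).right_inv hs').symm

/-- Lift a short path from `quo G x` to `q`, starting at `x`. The lift is smooth of the same length,
and its endpoint is the required `y`. -/
theorem exists_riemannianEDist_lt_of_quo {x : X} {q : MulAction.orbitRel.Quotient G X}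
    {r : ℝ≥0∞} (hr : riemannianEDist I (quo G x) q < r) :
    ∃ y : X, quo G y = q ∧ riemannianEDist I x y < r := by
  simp only [riemannianEDist, iInf_lt_iff, exists_prop] at hr ⊢
  obtain ⟨γ, hγ, hlen⟩ := hr
  have cov : IsCoveringMap (quo G (X := X)) :=
    isQuotientCoveringMap_quotientMk_of_properlyDiscontinuousSMul.isCoveringMap
  set Γ := cov.liftPath (γ : C(unitInterval, _)) x γ.source with hΓ
  have hlift : quo G ∘ Γ = γ := cov.liftPath_lifts _ x γ.source
  have hsm : ContMDiff (𝓡∂ 1) I 1 Γ := contMDiff_of_quo_comp I G Γ.continuous (by rwa [hlift])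
  refine ⟨Γ 1, by simpa using congr_fun hlift 1,
    ⟨Γ, cov.liftPath_zero _ x γ.source, rfl⟩, hsm, lt_of_le_of_lt (le_of_eq ?_) hlen⟩
  refine lintegral_congr fun t ↦ ?_
  have := enorm_mfderiv_quo_comp I G (hsm.mdifferentiable (by simp) t)
  rw [hlift] at this
  exact this.symm

end QuotientDistance

/-! ### Comparison of Fréchet means with equivariant Fréchet means. -/

section EquivariantMeans

variable {E : Type*} [NormedAddCommGroup E] [NormedSpace ℝ E]
  {H : Type*} [TopologicalSpace H] (I : ModelWithCorners ℝ E H)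
  (G : Type*) [Group G] {X : Type*} [EMetricSpace X] [ChartedSpace H X] [IsManifold I ∞ X]
  [RiemannianBundle (fun x : X ↦ TangentSpace I x)] [IsRiemannianManifold I X] [MulAction G X]
  [LocallyCompactSpace X]
  [Finite G] [ContinuousConstSMul G X] [IsCancelSMul G X] [IsRiemannianAction I G X]

/-- The Riemannian distance of the quotient is the distance between fibers. -/
theorem riemannianEDist_quo (q : MulAction.orbitRel.Quotient G X) (p : X) :
    riemannianEDist I q (quo G p) = equivariantDist G q p := by
  apply le_antisymm
  · refine Metric.le_infEDist.2 fun a ha ↦ ?_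
    rw [mem_preimage, mem_singleton_iff] at ha
    rw [← ha, riemannianEDist_comm, IsRiemannianManifold.out (I := I) p a]
    exact riemannianEDist_quo_le I G p a
  · refine le_of_forall_gt fun r hr ↦ ?_
    rw [riemannianEDist_comm] at hr
    obtain ⟨y, hy, hlt⟩ := exists_riemannianEDist_lt_of_quo I G hr
    rw [← IsRiemannianManifold.out (I := I) p y] at hlt
    exact (Metric.infEDist_le_edist_of_mem (by simpa using hy)).trans_lt hlt

theorem lintegral_empiricalMeasure {M : Type*} [MeasurableSpace M] [MeasurableSingletonClass M]
    {N : ℕ} (Q : Fin N → M) (f : M → ℝ≥0∞) :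
    ∫⁻ x, f x ∂empiricalMeasure Q = (N : ℝ≥0∞)⁻¹ * ∑ i, f (Q i) := by
  simp [empiricalMeasure, lintegral_smul_measure, lintegral_finsetSum_measure]

variable [MeasurableSpace (MulAction.orbitRel.Quotient G X)]
  [BorelSpace (MulAction.orbitRel.Quotient G X)] {N : ℕ}

theorem lintegral_riemannianEDist_quo (Q : Fin N → MulAction.orbitRel.Quotient G X) (p : X) :
    ∫⁻ x, riemannianEDist I x (quo G p) ^ 2 ∂empiricalMeasure Q =
      equivariantFrechetFun G Q p := by
  -- Hausdorffness makes singletons Borel, so that integration against Dirac masses is evaluation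
  -- without any measurability of the integrand.
  have : T2Space (MulAction.orbitRel.Quotient G X) :=
    t2Space_of_properlyDiscontinuousSMul_of_t2Space
  simp_rw [lintegral_empiricalMeasure, riemannianEDist_quo, equivariantFrechetFun]

theorem quo_mem_FM (Q : Fin N → MulAction.orbitRel.Quotient G X) (p : X) :
    quo G p ∈ FM I Q ↔ p ∈ EFM G Q := by
  refine (quo_surjective G X).forall.trans (forall_congr' fun p' ↦ ?_)
  rw [lintegral_riemannianEDist_quo, lintegral_riemannianEDist_quo]

theorem EFM_eq_preimage (Q : Fin N → MulAction.orbitRel.Quotient G X) :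
    EFM G Q = quo G ⁻¹' FM I Q :=
  Set.ext fun p ↦ (quo_mem_FM I G Q p).symm

theorem existsUnique_mem_FM (Q : Fin N → MulAction.orbitRel.Quotient G X) :
    (∃! p, p ∈ FM I Q) ↔ (EFM G Q).Nonempty ∧ EFMUniqueUpToAction G Q := by
  rw [EFM_eq_preimage I G Q]
  constructor
  · rintro ⟨q, hq, huniq⟩
    obtain ⟨p, rfl⟩ := quo_surjective G X q
    refine ⟨⟨p, hq⟩, fun a ha b hb ↦ (quo_eq_quo G).1 ?_⟩
    rw [EFM_eq_preimage I G Q] at ha hb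
    exact (huniq _ hb).trans (huniq _ ha).symm
  · rintro ⟨⟨p, hp⟩, huniq⟩
    refine ⟨quo G p, hp, (quo_surjective G X).forall.2 fun p' hp' ↦ (quo_eq_quo G).2 ?_⟩
    exact huniq p ((quo_mem_FM I G Q p).1 hp) p' ((quo_mem_FM I G Q p').1 hp')

end EquivariantMeans

/-! ### Existence of equivariant Fréchet means when closed balls are compact. -/

section Existence

variable (G : Type*) [Group G] {X : Type*} [MulAction G X]

theorem quo_preimage_singleton (x : X) : quo G ⁻¹' {quo G x} = range fun g : G ↦ g • x := by
  ext y
  simp [quo_eq_quo]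

variable [EMetricSpace X] {N : ℕ}

theorem continuous_equivariantFrechetFun (Q : Fin N → MulAction.orbitRel.Quotient G X) :
    Continuous (equivariantFrechetFun G Q) := by
  have hd : ∀ i, Continuous fun p ↦ equivariantDist G (Q i) p ^ 2 := fun i ↦
    (ENNReal.continuous_pow 2).comp Metric.continuous_infEDist
  -- For `N = 0` the factor `N⁻¹` is `⊤`, and multiplication by `⊤` is not continuous; there the sum
  -- is empty and the function vanishes.
  rcases N.eq_zero_or_pos with rfl | hN
  · have h0 : equivariantFrechetFun G Q = fun _ ↦ 0 := by
      ext p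
      simp [equivariantFrechetFun]
    rw [h0]
    exact continuous_const
  · exact (ENNReal.continuous_const_mul (by simpa using hN.ne')).comp
      (continuous_finsetSum _ fun i _ ↦ hd i)

/-- Coercivity: a single summand already controls the distance to the orbit of `x`, attained because
the fibre is finite. The bound `t ≤ 1 + t²` avoids taking a square root. -/
theorem exists_edist_smul_le_equivariantFrechetFun [Finite G]
    (Q : Fin N → MulAction.orbitRel.Quotient G X) {i : Fin N} {x : X} (hx : quo G x = Q i)
    (p : X) : ∃ g : G, edist p (g • x) ≤ 1 + N * equivariantFrechetFun G Q p := by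
  obtain ⟨y, hy, hpy⟩ := ((quo_preimage_singleton G x ▸
    finite_range _ : (quo G ⁻¹' {quo G x}).Finite).isCompact).exists_infEDist_eq_edist
      ⟨x, rfl⟩ p
  rw [quo_preimage_singleton] at hy
  obtain ⟨g, rfl⟩ := hy
  refine ⟨g, ?_⟩
  have hN : (N : ℝ≥0∞) ≠ 0 := by
    simpa using i.pos.ne'
  rw [equivariantFrechetFun, ← mul_assoc, ENNReal.mul_inv_cancel hN (by simp), one_mul]
  have h1 : edist p (g • x) ^ 2 ≤ ∑ i, equivariantDist G (Q i) p ^ 2 := by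
    rw [← hpy, hx]
    exact Finset.single_le_sum (f := fun i ↦ equivariantDist G (Q i) p ^ 2)
      (fun _ _ ↦ zero_le) (Finset.mem_univ i)
  rcases le_total (edist p (g • x)) 1 with h | h
  · exact h.trans le_self_add
  · exact ((le_self_pow₀ h two_ne_zero).trans h1).trans le_add_self

/-- If closed balls are compact, equivariant Fréchet means exist. -/
theorem EFM_nonempty [Finite G]
    (hX : ∀ (x : X) (r : NNReal), IsCompact (Metric.closedEBall x (r : ℝ≥0∞))) (hN : 1 ≤ N)
    (Q : Fin N → MulAction.orbitRel.Quotient G X) : (EFM G Q).Nonempty := by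
  obtain ⟨x, hx⟩ := quo_surjective G X (Q ⟨0, hN⟩)
  -- The function may be identically `⊤`, for instance when two of the `q_i` lie in different
  -- components of the quotient; then every point is a minimizer.
  by_cases hf : ∃ p₀, equivariantFrechetFun G Q p₀ ≠ ⊤
  · obtain ⟨p₀, hp₀⟩ := hf
    set m := equivariantFrechetFun G Q p₀ with hm
    have hr : (1 + N * m) ≠ ⊤ := by finiteness
    have hK : IsCompact {p | equivariantFrechetFun G Q p ≤ m} := by
      refine (isCompact_iUnion fun g : G ↦ hX (g • x) (1 + N * m).toNNReal).of_isClosed_subset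
        (isClosed_le (continuous_equivariantFrechetFun G Q) continuous_const) fun p hp ↦ ?_
      obtain ⟨g, hg⟩ := exists_edist_smul_le_equivariantFrechetFun G Q hx p
      refine mem_iUnion.2 ⟨g, ?_⟩
      rw [Metric.mem_closedEBall, ENNReal.coe_toNNReal hr]
      refine hg.trans ?_
      gcongr
      exact hp
    obtain ⟨p, hp, hmin⟩ := hK.exists_isMinOn ⟨p₀, hm.ge⟩
      (continuous_equivariantFrechetFun G Q).continuousOn
    refine ⟨p, fun p' ↦ ?_⟩
    -- The minimum over the sublevel set is global, since competitors outside it have value at least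
    -- `m`.
    rcases le_total (equivariantFrechetFun G Q p') m with h | h
    · exact hmin h
    · exact le_trans hp h
  · push Not at hf
    exact ⟨x, fun p' ↦ by rw [hf, hf]⟩

end Existence

end EquivariantMean

theorem mainTheorem10 {n : ℕ} {X : Type*} [EMetricSpace X]
    [ChartedSpace (EuclideanSpace ℝ (Fin n)) X] [IsManifold (𝓡 n) ∞ X] [LocallyCompactSpace X]
    [RiemannianBundle (fun x : X ↦ TangentSpace (𝓡 n) x)]
    [IsContMDiffRiemannianBundle (𝓡 n) ∞ (EuclideanSpace ℝ (Fin n))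
      (fun x : X ↦ TangentSpace (𝓡 n) x)]
    [IsRiemannianManifold (𝓡 n) X]
    (G : Type*) [Group G] [Finite G] [MulAction G X] [ContinuousConstSMul G X] [IsCancelSMul G X]
    [EquivariantMean.IsRiemannianAction (𝓡 n) G X]
    [MeasurableSpace (MulAction.orbitRel.Quotient G X)]
    [BorelSpace (MulAction.orbitRel.Quotient G X)]
    {N : ℕ} (hN : 1 ≤ N) (Q : Fin N → MulAction.orbitRel.Quotient G X) :
    (∀ p : X, List.TFAE [
      EquivariantMean.quo G p ∈ EquivariantMean.FM (𝓡 n) Q,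
      p ∈ EquivariantMean.EFM G Q,
      EquivariantMean.quo G ⁻¹' {EquivariantMean.quo G p} ⊆ EquivariantMean.EFM G Q]) ∧
    EquivariantMean.EFM G Q = EquivariantMean.quo G ⁻¹' EquivariantMean.FM (𝓡 n) Q ∧
    EquivariantMean.quo G '' EquivariantMean.EFM G Q = EquivariantMean.FM (𝓡 n) Q ∧
    ((∃! p, p ∈ EquivariantMean.FM (𝓡 n) Q) ↔
      (EquivariantMean.EFM G Q).Nonempty ∧ EquivariantMean.EFMUniqueUpToAction G Q) ∧
    (CompleteSpace X → ((∃! p, p ∈ EquivariantMean.FM (𝓡 n) Q) ↔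
      EquivariantMean.EFMUniqueUpToAction G Q)) := by
  have hEFM := EquivariantMean.EFM_eq_preimage (𝓡 n) G Q
  refine ⟨fun p ↦ ?_, hEFM, ?_, EquivariantMean.existsUnique_mem_FM (𝓡 n) G Q, fun _ ↦ ?_⟩
  · tfae_have 1 ↔ 2 := EquivariantMean.quo_mem_FM (𝓡 n) G Q p
    tfae_have 1 → 3 := by
      rintro h p' hp'
      rw [hEFM]
      rwa [mem_preimage, mem_singleton_iff.1 hp']
    tfae_have 3 → 2 := fun h ↦ h rfl
    tfae_finish
  · rw [hEFM, image_preimage_eq _ (EquivariantMean.quo_surjective G X)]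
  · rw [EquivariantMean.existsUnique_mem_FM (𝓡 n) G Q, and_iff_right]
    exact EquivariantMean.EFM_nonempty G
      (IsRiemannianManifold.hasIntermediatePoints (𝓡 n)).isCompact_closedEBall hN Q
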